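/- Let $2^{\mathbb N}$ be Cantor space, let $\mu$ be Haar measure on it (the product of the fair coin-flipping measures on the factors $\{0,1\}$), and let $G=\mathrm{Homeo}(2^{\mathbb N},\mu)$ be the group of $\mu$-preserving homeomorphisms of $2^{\mathbb N}$ with the compact-open topology (equivalently, the topology of uniform convergence). Call $g\in G$ generic if its conjugacy class $\{fgf^{-1} : f\in G\}$ is comeagre in $G$. Then generic elements of $G$ exist, and every generic $g\in G$ has the following properties: (1) for every integer $n\neq 0$, $g$ is conjugate in $G$ to $g^n$; (2) $g$ has roots of all orders in $G$: for every integer $n\geq 1$ there is $f\in G$ with $f^n=g$; (3) there is an action of $(\mathbb Q,+)$ on $2^{\mathbb N}$ by $\mu$-preserving homeomorphisms, that is, a group homomorphism $a\colon(\mathbb Q,+)\to G$, such that $a(1)=g$. -/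

import Mathlib

open MeasureTheory

/-- Cantor space `2^ℕ`, with the product of the discrete topologies and the product (equivalently,
Borel) σ-algebra. -/
abbrev Cantor : Type := ℕ → Bool

/-- Haar measure on Cantor space: the product of the fair coin-flipping measures on the factors. -/
noncomputable def cantorHaar : Measure Cantor :=
  Measure.infinitePi fun _ : ℕ => (PMF.uniformOfFintype Bool).toMeasure

/-- The compact-open topology on the homeomorphism group of a space `X`, induced from the
compact-open topology on continuous maps. For compact metric `X` this is the topology of uniform
convergence. -/
instance homeoTopology {X : Type*} [TopologicalSpace X] : TopologicalSpace (X ≃ₜ X) :=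
  TopologicalSpace.induced (fun h => (h : C(X, X))) inferInstance

/-- The group of homeomorphisms of Cantor space that preserve Haar measure, a subgroup of the
homeomorphism group (multiplication is composition) with the subspace topology. -/
def HomeoHaar : Subgroup (Cantor ≃ₜ Cantor) where
  carrier := {h | MeasurePreserving h cantorHaar cantorHaar}
  mul_mem' {a b} ha hb := by
    have ha' : MeasurePreserving a cantorHaar cantorHaar := ha
    have hb' : MeasurePreserving b cantorHaar cantorHaar := hb
    exact ha'.comp hb'
  one_mem' := MeasurePreserving.id cantorHaar
  inv_mem' {a} ha := by
    have ha' : MeasurePreserving a.toMeasurableEquiv cantorHaar cantorHaar := ha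
    exact MeasurePreserving.symm a.toMeasurableEquiv ha'

/-- An element of a topological group is generic if its conjugacy class is comeagre. -/
def IsGenericElement {G : Type*} [Group G] [TopologicalSpace G] (g : G) : Prop :=
  {h : G | IsConj g h} ∈ residual G

/-! Call $g$ universal if it permutes the words of length $m$ for arbitrarily large $m$
(`PermutesWords`), and if every finite skew product over the words of length $N$, with fibre the
words of length $j$, is realized along $g$ by an equidistributed map (`RealizesCocycles`). Each
property is a countable intersection of dense open sets and $G$ is Baire, so universal elements are
comeagre.

Any two universal elements are conjugate, by back and forth through common finite factors
(`CommonFactor.exists_refines`). By the first property, a factor of $g$ is refined by the action of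
$g$ on long words, a skew product over the factor; by the second, $g'$ realizes the same skew
product. In the limit the factor maps match up points. Thus the generic elements are exactly the
conjugates of universal ones.

Nonzero powers of universal elements are universal: for positive powers a cocycle is replaced by a
root of it acting on tuples, and for inverses the equation is read backwards. Hence $g \sim g^n$,
and conjugating back gives a root of $g$ in its own class. Iterated, this gives $u_{k+1}^{k+1}=u_k$
with $u_0=g$, and $z/k!\mapsto u_k^z$ is the action of $\mathbb Q$. -/

/-! ### Finite words and equidistributed maps -/

/-- Binary words of length `n`. -/
abbrev Word (n : ℕ) : Type := Fin n → Bool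

/-- The first `n` digits of a point of Cantor space. -/
def trunc (n : ℕ) (x : Cantor) : Word n := fun i => x i

/-- The first `m` digits of a word of length `n`. -/
def wordTrunc {m n : ℕ} (h : m ≤ n) (d : Word n) : Word m := fun i => d (Fin.castLE h i)

theorem wordTrunc_trunc {m n : ℕ} (h : m ≤ n) (x : Cantor) :
    wordTrunc h (trunc n x) = trunc m x := rfl

theorem trunc_eq_of_le {m n : ℕ} (h : m ≤ n) {x y : Cantor} (hxy : trunc n x = trunc n y) :
    trunc m x = trunc m y := by
  rw [← wordTrunc_trunc h, hxy, wordTrunc_trunc]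

theorem trunc_surjective (n : ℕ) : Function.Surjective (trunc n) := fun d =>
  ⟨fun i => if h : i < n then d ⟨i, h⟩ else false, by ext i; simp [trunc]⟩

theorem ext_trunc {x y : Cantor} (h : ∀ n, trunc n x = trunc n y) : x = y := by
  ext n
  exact congrFun (h (n + 1)) (Fin.last n)

theorem continuous_trunc (n : ℕ) : Continuous (trunc n) :=
  continuous_pi fun i => continuous_apply (i : ℕ)

/-- A map all of whose fibres have the same size: up to a bijection, a product projection. -/
def EquiFibered {D C : Type} (f : D → C) : Prop :=
  ∃ (K : Type) (e : D ≃ C × K), ∀ d, (e d).1 = f d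

namespace EquiFibered

variable {B C D : Type}

theorem of_equiv (e : D ≃ C) : EquiFibered e :=
  ⟨Unit, e.trans (Equiv.prodPUnit C).symm, fun _ => rfl⟩

theorem fst (K : Type) : EquiFibered (Prod.fst : C × K → C) := ⟨K, Equiv.refl _, fun _ => rfl⟩

theorem comp {f : D → C} {g : C → B} (hg : EquiFibered g) (hf : EquiFibered f) :
    EquiFibered (fun d => g (f d)) := by
  obtain ⟨K, e, he⟩ := hf
  obtain ⟨J, i, hi⟩ := hg
  refine ⟨J × K, (e.trans (i.prodCongr (Equiv.refl K))).trans (Equiv.prodAssoc B J K), fun d => ?_⟩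
  simp [he, hi]

theorem prodMap {B' D' : Type} {f : D → B} {g : D' → B'} (hf : EquiFibered f)
    (hg : EquiFibered g) : EquiFibered (Prod.map f g) := by
  obtain ⟨K, e, he⟩ := hf
  obtain ⟨J, i, hi⟩ := hg
  refine ⟨K × J, (e.prodCongr i).trans (Equiv.prodProdProdComm B K B' J), fun d => ?_⟩
  simp [Prod.map, he, hi]

theorem eval_zero (K : Type) (m : ℕ) : EquiFibered (fun k : Fin (m + 1) → K => k 0) :=
  ⟨Fin m → K, (Fin.consEquiv fun _ => K).symm, fun _ => rfl⟩

theorem _root_.equiFibered_wordTrunc {m n : ℕ} (h : m ≤ n) : EquiFibered (wordTrunc h) := by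
  obtain ⟨k, rfl⟩ := Nat.exists_eq_add_of_le h
  exact ⟨Word k, (Fin.appendEquiv m k).symm, fun _ => rfl⟩

/-- Finite fibres of constant cardinality. -/
theorem of_card [Finite D] {f : D → C} (k : ℕ) (h : ∀ c, Nat.card {d // f d = c} = k) :
    EquiFibered f := by
  let e : ∀ c, {d // f d = c} ≃ Fin k := fun c => Finite.equivFinOfCardEq (h c)
  exact ⟨Fin k, (Equiv.sigmaFiberEquiv f).symm.trans
    ((Equiv.sigmaCongrRight e).trans (Equiv.sigmaEquivProd C (Fin k))), fun _ => rfl⟩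

/-- Two maps with constant fibre sizes between the same finite sets differ by a permutation. -/
theorem exists_perm [Finite D] [Nonempty C] {f f' : D → C} (hf : EquiFibered f)
    (hf' : EquiFibered f') : ∃ e : Equiv.Perm D, ∀ d, f' (e d) = f d := by
  obtain ⟨K, e, he⟩ := hf
  obtain ⟨J, i, hi⟩ := hf'
  have hCK : Finite (C × K) := Finite.of_equiv D e
  have hCJ : Finite (C × J) := Finite.of_equiv D i
  have hK : Finite K := Finite.prod_right C
  have hJ : Finite J := Finite.prod_right C
  have : Nonempty (K ≃ J) := by
    -- `C` need not be finite, but if it is infinite then finiteness of the products forces both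
    -- fibres to be empty.
    by_cases hC : Finite C
    · have h := Nat.card_congr (e.symm.trans i)
      rw [Nat.card_prod, Nat.card_prod] at h
      exact Finite.card_eq.1 (Nat.eq_of_mul_eq_mul_left Nat.card_pos h)
    · have h1 : IsEmpty K := by
        by_contra h
        rw [not_isEmpty_iff] at h
        exact hC (Finite.prod_left K)
      have h2 : IsEmpty J := by
        by_contra h
        rw [not_isEmpty_iff] at h
        exact hC (Finite.prod_left J)
      exact ⟨Equiv.equivOfIsEmpty K J⟩
  obtain ⟨q⟩ := this
  refine ⟨(e.trans ((Equiv.refl C).prodCongr q)).trans i.symm, fun d => ?_⟩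
  rw [← hi, ← he]
  simp

theorem surjective_of_nonempty [Nonempty D] {f : D → C} (hf : EquiFibered f) :
    Function.Surjective f := by
  obtain ⟨K, e, he⟩ := hf
  intro c
  obtain ⟨d⟩ := ‹Nonempty D›
  exact ⟨e.symm (c, (e d).2), by rw [← he]; simp⟩

end EquiFibered

/-- A locally constant map on Cantor space whose fibres all have the same Haar measure. -/
def Equidistributed {C : Type} (p : Cantor → C) : Prop :=
  ∃ (n : ℕ) (f : Word n → C), EquiFibered f ∧ ∀ x, p x = f (trunc n x)

namespace Equidistributed

variable {C D : Type} {p : Cantor → C}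

theorem _root_.equidistributed_trunc (n : ℕ) : Equidistributed (trunc n) :=
  ⟨n, id, EquiFibered.of_equiv (Equiv.refl _), fun _ => rfl⟩

theorem unit : Equidistributed fun _ : Cantor => () :=
  ⟨0, fun _ => (), ⟨Unit, ⟨fun _ => ((), ()), fun _ => default, fun _ => Subsingleton.elim _ _, fun _ => rfl⟩,
    fun _ => rfl⟩, fun _ => rfl⟩

theorem comp (hp : Equidistributed p) {f : C → D} (hf : EquiFibered f) :
    Equidistributed fun x => f (p x) := by
  obtain ⟨n, u, hu, h⟩ := hp
  exact ⟨n, _, hf.comp hu, fun x => congrArg f (h x)⟩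

theorem exists_factor (hp : Equidistributed p) :
    ∃ N, ∀ m ≥ N, ∃ f : Word m → C, EquiFibered f ∧ ∀ x, p x = f (trunc m x) := by
  obtain ⟨n, u, hu, h⟩ := hp
  exact ⟨n, fun m hm => ⟨_, hu.comp (equiFibered_wordTrunc hm), fun x => by
    rw [h, wordTrunc_trunc]⟩⟩

theorem surjective (hp : Equidistributed p) : Function.Surjective p := by
  obtain ⟨n, u, hu, h⟩ := hp
  intro c
  obtain ⟨d, rfl⟩ := hu.surjective_of_nonempty c
  obtain ⟨x, rfl⟩ := trunc_surjective n d
  exact ⟨x, h x⟩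

theorem isLocallyConstant (hp : Equidistributed p) : IsLocallyConstant p := by
  obtain ⟨n, u, hu, h⟩ := hp
  have : p = u ∘ trunc n := funext h
  rw [this]
  exact ((IsLocallyConstant.iff_continuous _).2 (continuous_trunc n)).comp u

/-- The values of an equidistributed map can be split evenly. -/
theorem exists_prod (hp : Equidistributed p) (j : ℕ) :
    ∃ s : Cantor → Word j, Equidistributed fun x => (p x, s x) := by
  obtain ⟨n, u, hu, h⟩ := hp
  refine ⟨fun x i => x (n + i), n + j, fun d => (u ((Fin.appendEquiv n j).symm d).1,
    ((Fin.appendEquiv n j).symm d).2), ?_, fun x => ?_⟩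
  · exact (hu.prodMap (EquiFibered.of_equiv (Equiv.refl (Word j)))).comp
      (EquiFibered.of_equiv (Fin.appendEquiv n j).symm)
  · exact congrArg (fun c => (c, fun i : Fin j => x (n + i))) (h x)

end Equidistributed

/-- A locally constant map on Cantor space depends on finitely many digits only. -/
theorem IsLocallyConstant.exists_trunc {C : Type*} {p : Cantor → C} (hp : IsLocallyConstant p) :
    ∃ N, ∀ x y, trunc N x = trunc N y → p x = p y := by
  let W : ℕ → Set Cantor := fun N => {x | ∀ y, trunc N x = trunc N y → p x = p y}
  have hopen : ∀ N, IsOpen (W N) := fun N => by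
    rw [isOpen_iff_mem_nhds]
    intro x hx
    have h1 : {y | trunc N y = trunc N x} ∈ nhds x :=
      (((IsLocallyConstant.iff_continuous _).2 (continuous_trunc N)).isOpen_fiber _).mem_nhds rfl
    filter_upwards [h1] with y hy z hz
    rw [← hx z (hy.symm.trans hz), hx y hy.symm]
  have hcov : Set.univ ⊆ ⋃ N, W N := by
    intro x _
    have hx := (PiNat.isTopologicalBasis_cylinders (E := fun _ => Bool)).mem_nhds_iff.1
      ((hp.isOpen_fiber (p x)).mem_nhds rfl)
    obtain ⟨_, ⟨z, n, rfl⟩, hxz, hsub⟩ := hx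
    refine Set.mem_iUnion.2 ⟨n, fun y hy => ((hsub ?_ : p y = p x)).symm⟩
    rw [PiNat.mem_cylinder_iff] at hxz ⊢
    exact fun i hi => (congrFun hy ⟨i, hi⟩).symm.trans (hxz i hi)
  have hmono : Monotone W := fun m n hmn x hx y hy => hx y (trunc_eq_of_le hmn hy)
  obtain ⟨N, hN⟩ := isCompact_univ.elim_directed_cover W hopen hcov hmono.directed_le
  exact ⟨N, fun x y h => hN (Set.mem_univ x) y h⟩

theorem isLocallyConstant_trunc (n : ℕ) : IsLocallyConstant (trunc n) :=
  (IsLocallyConstant.iff_continuous _).2 (continuous_trunc n)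

/-! ### Equidistributed maps and Haar measure -/

instance : IsProbabilityMeasure cantorHaar := by
  unfold cantorHaar
  infer_instance

theorem cantorHaar_trunc_preimage_singleton (n : ℕ) (d : Word n) :
    cantorHaar (trunc n ⁻¹' {d}) = (2 ^ n)⁻¹ := by
  obtain ⟨y, rfl⟩ := trunc_surjective n d
  have h : trunc n ⁻¹' {trunc n y} = Set.pi (Finset.range n : Set ℕ) fun i => {y i} := by
    ext x
    simp only [Set.mem_preimage, Set.mem_singleton_iff, Set.mem_pi, Finset.coe_range,
      Set.mem_Iio]
    exact ⟨fun h i hi => congrFun h ⟨i, hi⟩, fun h => funext fun i => h i i.2⟩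
  rw [h, cantorHaar, Measure.infinitePi_pi _ (fun i _ => measurableSet_singleton _)]
  simp [ENNReal.inv_pow]

theorem measurableSet_preimage_of_isLocallyConstant {C : Type*} {p : Cantor → C}
    (hp : IsLocallyConstant p) (S : Set C) : MeasurableSet (p ⁻¹' S) :=
  (hp S).measurableSet

theorem cantorHaar_trunc_preimage (n : ℕ) (S : Set (Word n)) :
    cantorHaar (trunc n ⁻¹' S) = S.ncard * (2 ^ n)⁻¹ := by
  classical
  have h := sum_measure_preimage_singleton (μ := cantorHaar) S.toFinset (f := trunc n)
    fun d _ => measurableSet_preimage_of_isLocallyConstant (isLocallyConstant_trunc n) {d}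
  rw [Set.coe_toFinset] at h
  rw [← h]
  simp [cantorHaar_trunc_preimage_singleton, Set.ncard_eq_toFinset_card']

/-- Equidistributed maps onto words of length `n` have fibres of measure `2⁻ⁿ`. -/
theorem Equidistributed.cantorHaar_preimage_singleton {n : ℕ} {p : Cantor → Word n}
    (hp : Equidistributed p) (d : Word n) : cantorHaar (p ⁻¹' {d}) = (2 ^ n)⁻¹ := by
  obtain ⟨m, f, ⟨K, e, he⟩, h⟩ := hp
  have hfin : Finite (Word n × K) := Finite.of_equiv _ e
  have hK : Finite K := Finite.prod_right (Word n)
  have hcard := Nat.card_congr e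
  have hpre : p ⁻¹' {d} = trunc m ⁻¹' (f ⁻¹' {d}) := by ext x; simp [h]
  have hfib : (f ⁻¹' {d}).ncard = Nat.card K := by
    rw [← Nat.card_coe_set_eq]
    refine Nat.card_congr ⟨fun x => (e x).2, fun k => ⟨e.symm (d, k), ?_⟩, fun x => ?_, fun k => ?_⟩
    · simp [← he]
    · have hx : f x = d := x.2
      ext1
      apply e.injective
      simp only [Equiv.apply_symm_apply]
      exact Prod.ext ((he _).trans hx).symm rfl
    · simp
  rw [hpre, cantorHaar_trunc_preimage, hfib]
  simp only [Nat.card_prod, Nat.card_eq_fintype_card (α := Word _), Fintype.card_fun,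
    Fintype.card_bool, Fintype.card_fin] at hcard
  have hc : (2 ^ m : ENNReal) = 2 ^ n * (Nat.card K : ENNReal) := by exact_mod_cast hcard
  have hK0 : (Nat.card K : ENNReal) ≠ 0 := by
    intro h0
    rw [h0, mul_zero] at hc
    exact pow_ne_zero m two_ne_zero hc
  rw [hc, ENNReal.mul_inv (Or.inr (ENNReal.natCast_ne_top _)) (Or.inr hK0), mul_comm, mul_assoc,
    ENNReal.inv_mul_cancel hK0 (ENNReal.natCast_ne_top _), mul_one]

/-- A continuous map is measure preserving if its finite truncations are equidistributed. -/
theorem measurePreserving_of_equidistributed {h : Cantor → Cantor} (hc : Continuous h)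
    (hh : ∀ k, Equidistributed fun x => trunc k (h x)) :
    MeasurePreserving h cantorHaar cantorHaar := by
  classical
  refine ⟨hc.measurable, Measure.eq_infinitePi _ fun s t ht => ?_⟩
  -- A box constrains finitely many coordinates, so it is a union of cylinders of one length `k`.
  have hk : ∃ k, ∀ i ∈ s, i < k :=
    ⟨s.sup id + 1, fun i hi => Nat.lt_succ_of_le (Finset.le_sup (f := id) hi)⟩
  obtain ⟨k, hk⟩ := hk
  have hpi : Set.pi (s : Set ℕ) t = trunc k ⁻¹' {d | ∀ i : Fin k, (i : ℕ) ∈ s → d i ∈ t i} := by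
    ext x
    exact ⟨fun hx i hi => hx i hi, fun hx i hi => hx ⟨i, hk i hi⟩ hi⟩
  rw [← Measure.infinitePi_pi _ (fun i _ => ht i)]
  change _ = cantorHaar _
  rw [Measure.map_apply hc.measurable (MeasurableSet.pi s.countable_toSet fun i _ => ht i), hpi]
  generalize {d : Word k | ∀ i : Fin k, (i : ℕ) ∈ s → d i ∈ t i} = S
  rw [← Set.preimage_comp]
  have h1 := sum_measure_preimage_singleton (μ := cantorHaar) S.toFinset (f := trunc k)
    fun d _ => measurableSet_preimage_of_isLocallyConstant (isLocallyConstant_trunc k) {d}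
  have h2 := sum_measure_preimage_singleton (μ := cantorHaar) S.toFinset (f := trunc k ∘ h)
    fun d _ => measurableSet_preimage_of_isLocallyConstant (hh k).isLocallyConstant {d}
  rw [Set.coe_toFinset] at h1 h2
  rw [← h1, ← h2]
  refine Finset.sum_congr rfl fun d _ => ?_
  rw [cantorHaar_trunc_preimage_singleton]
  exact (hh k).cantorHaar_preimage_singleton d

/-- The truncations of a continuous measure preserving map are equidistributed. -/
theorem MeasureTheory.MeasurePreserving.equidistributed_trunc {h : Cantor → Cantor}
    (hh : MeasurePreserving h cantorHaar cantorHaar) (hc : Continuous h) (k : ℕ) :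
    Equidistributed fun x => trunc k (h x) := by
  have hlc : IsLocallyConstant fun x => trunc k (h x) :=
    (IsLocallyConstant.iff_continuous _).2 ((continuous_trunc k).comp hc)
  obtain ⟨N, hN⟩ := hlc.exists_trunc
  obtain ⟨lift, hlift⟩ := (trunc_surjective N).hasRightInverse
  refine ⟨N, fun d => trunc k (h (lift d)), ?_, fun x => hN _ _ (hlift _).symm⟩
  have hf : ∀ x, trunc k (h (lift (trunc N x))) = trunc k (h x) := fun x => hN _ _ (hlift _)
  -- The measure of a fibre is computed twice: by counting words of length `N`, and as $2^{-k}$ by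
  -- invariance.
  have key : ∀ c, (Nat.card {d // trunc k (h (lift d)) = c} : ENNReal) = 2 ^ N * (2 ^ k)⁻¹ := by
    intro c
    have h1 : cantorHaar (trunc N ⁻¹' {d | trunc k (h (lift d)) = c}) = (2 ^ k)⁻¹ := by
      rw [← cantorHaar_trunc_preimage_singleton k c,
        ← hh.measure_preimage (measurableSet_preimage_of_isLocallyConstant
          (isLocallyConstant_trunc k) {c}).nullMeasurableSet]
      congr 1
      ext x
      simp [hf]
    rw [cantorHaar_trunc_preimage] at h1
    have h2 : Nat.card {d // trunc k (h (lift d)) = c} =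
        {d | trunc k (h (lift d)) = c}.ncard := Nat.card_coe_set_eq _
    rw [h2, ← h1, mul_comm, mul_assoc, ENNReal.inv_mul_cancel (by positivity) (by simp), mul_one]
  refine EquiFibered.of_card (Nat.card {d // trunc k (h (lift d)) = fun _ => false}) fun c => ?_
  have := (key c).trans (key fun _ => false).symm
  exact_mod_cast this

/-! ### Homeomorphisms permuting finite words -/

/-- Apply a transformation of words of length `n` to the first `n` digits of a sequence. -/
def applyInitial {n : ℕ} (f : Word n → Word n) (x : Cantor) : Cantor := fun i =>
  if h : i < n then f (trunc n x) ⟨i, h⟩ else x i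

theorem trunc_applyInitial {n : ℕ} (f : Word n → Word n) (x : Cantor) :
    trunc n (applyInitial f x) = f (trunc n x) := by
  ext i
  simp [trunc, applyInitial]

theorem applyInitial_applyInitial {n : ℕ} (f g : Word n → Word n) (x : Cantor) :
    applyInitial f (applyInitial g x) = applyInitial (fun d => f (g d)) x := by
  ext i
  by_cases h : i < n
  · simp only [applyInitial, h, dite_true]
    exact congrFun (congrArg f (trunc_applyInitial g x)) ⟨i, h⟩
  · simp [applyInitial, h]

theorem applyInitial_id {n : ℕ} (x : Cantor) : applyInitial (fun d : Word n => d) x = x := by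
  ext i
  simp [applyInitial, trunc]

theorem continuous_applyInitial {n : ℕ} (f : Word n → Word n) : Continuous (applyInitial f) := by
  refine continuous_pi fun i => ?_
  by_cases h : i < n
  · have : (fun x => applyInitial f x i) = (fun d => f d ⟨i, h⟩) ∘ trunc n := by
      ext x
      simp [applyInitial, h]
    rw [this]
    exact continuous_of_discreteTopology.comp (continuous_trunc n)
  · simp only [applyInitial, h, dite_false]
    exact continuous_apply i

/-- The homeomorphism of Cantor space applying a permutation of words to the first `n` digits. -/
def permHomeomorph {n : ℕ} (e : Equiv.Perm (Word n)) : Cantor ≃ₜ Cantor where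
  toFun := applyInitial e
  invFun := applyInitial e.symm
  left_inv x := by simp [applyInitial_applyInitial, applyInitial_id]
  right_inv x := by simp [applyInitial_applyInitial, applyInitial_id]
  continuous_toFun := continuous_applyInitial _
  continuous_invFun := continuous_applyInitial _

theorem equidistributed_applyInitial {n : ℕ} (e : Equiv.Perm (Word n)) (k : ℕ) :
    Equidistributed fun x => trunc k (applyInitial e x) := by
  -- On words of length `n + j` the map acts as the permutation `e × id`; other lengths follow by
  -- truncating.
  suffices h : ∀ j, Equidistributed fun x => trunc (n + j) (applyInitial e x) from
    (h k).comp (equiFibered_wordTrunc (Nat.le_add_left k n))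
  intro j
  let E : Equiv.Perm (Word (n + j)) :=
    ((Fin.appendEquiv n j).symm.trans (e.prodCongr (Equiv.refl _))).trans (Fin.appendEquiv n j)
  have hE : ∀ x, trunc (n + j) (applyInitial e x) = E (trunc (n + j) x) := by
    intro x
    apply (Fin.appendEquiv n j).symm.injective
    simp only [E, Equiv.trans_apply, Equiv.symm_apply_apply]
    refine Prod.ext (trunc_applyInitial e x) (funext fun i => ?_)
    simp [trunc, applyInitial]
  simp only [hE]
  exact (equidistributed_trunc _).comp (EquiFibered.of_equiv E)

/-- The measure preserving homeomorphism applying a permutation to the first `n` digits. -/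
def permHaar {n : ℕ} (e : Equiv.Perm (Word n)) : HomeoHaar :=
  ⟨permHomeomorph e, measurePreserving_of_equidistributed (continuous_applyInitial e)
    (equidistributed_applyInitial e)⟩

/-- The underlying map of a measure preserving homeomorphism. -/
def HomeoHaar.map (g : HomeoHaar) (x : Cantor) : Cantor := g.1 x

namespace HomeoHaar

theorem map_one (x : Cantor) : map 1 x = x := rfl

theorem map_mul (g h : HomeoHaar) (x : Cantor) : map (g * h) x = map g (map h x) := rfl

theorem map_inv_map (g : HomeoHaar) (x : Cantor) : map g⁻¹ (map g x) = x := by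
  rw [← map_mul, inv_mul_cancel, map_one]

theorem map_map_inv (g : HomeoHaar) (x : Cantor) : map g (map g⁻¹ x) = x := by
  rw [← map_mul, mul_inv_cancel, map_one]

theorem ext_map {g h : HomeoHaar} (H : ∀ x, map g x = map h x) : g = h :=
  Subtype.ext (Homeomorph.ext H)

theorem continuous_map (g : HomeoHaar) : Continuous (map g) := g.1.continuous

theorem equidistributed_trunc_map (g : HomeoHaar) (k : ℕ) :
    Equidistributed fun x => trunc k (map g x) :=
  MeasurePreserving.equidistributed_trunc g.2 g.1.continuous k

theorem trunc_map_permHaar {n : ℕ} (e : Equiv.Perm (Word n)) (x : Cantor) :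
    trunc n (map (permHaar e) x) = e (trunc n x) := trunc_applyInitial e x

end HomeoHaar

open HomeoHaar

/-- Equidistributed maps onto the same finite set are conjugate by a permutation of words. -/
theorem Equidistributed.exists_perm {C : Type} {p q : Cantor → C} (hp : Equidistributed p)
    (hq : Equidistributed q) (N : ℕ) :
    ∃ n ≥ N, ∃ e : Equiv.Perm (Word n), ∀ x, q (map (permHaar e) x) = p x := by
  obtain ⟨n₁, h₁⟩ := hp.exists_factor
  obtain ⟨n₂, h₂⟩ := hq.exists_factor
  obtain ⟨u, hu, hpu⟩ := h₁ (max N (max n₁ n₂)) (by simp)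
  obtain ⟨v, hv, hqv⟩ := h₂ (max N (max n₁ n₂)) (by simp)
  have : Nonempty C := ⟨p fun _ => false⟩
  obtain ⟨e, he⟩ := hu.exists_perm hv
  exact ⟨_, le_max_left _ _, e, fun x => by rw [hqv, trunc_map_permHaar, he, hpu]⟩

/-! ### The topology of the group of measure preserving homeomorphisms -/

theorem HomeoHaar.isInducing_coe :
    Topology.IsInducing fun g : HomeoHaar => ((g : Cantor ≃ₜ Cantor) : C(Cantor, Cantor)) :=
  Topology.IsInducing.comp (g := fun h : Cantor ≃ₜ Cantor => (h : C(Cantor, Cantor))) ⟨rfl⟩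
    Topology.IsInducing.subtypeVal

/-- By compactness `q` has finitely many values, so the condition is a finite intersection of
subbasic sets, sending compact fibres of `q` into open fibres of `p`. -/
theorem isOpen_setOf_forall_comp_eq {C : Type*} {p q : Cantor → C} (hp : IsLocallyConstant p)
    (hq : IsLocallyConstant q) : IsOpen {f : C(Cantor, Cantor) | ∀ x, p (f x) = q x} := by
  have : {f : C(Cantor, Cantor) | ∀ x, p (f x) = q x} =
      ⋂ c ∈ Set.range q, {f : C(Cantor, Cantor) | Set.MapsTo f (q ⁻¹' {c}) (p ⁻¹' {c})} := by
    ext f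
    simp only [Set.mem_iInter]
    exact ⟨fun h c _ x hx => (h x).trans hx, fun h x => h (q x) ⟨x, rfl⟩ rfl⟩
  rw [this]
  refine hq.range_finite.isOpen_biInter fun c _ => ?_
  exact ContinuousMap.isOpen_setOfPred_mapsTo (hq.isClosed_fiber c).isCompact (hp.isOpen_fiber c)

theorem HomeoHaar.isOpen_setOf_forall_comp_eq {C : Type*} {p q : Cantor → C}
    (hp : IsLocallyConstant p) (hq : IsLocallyConstant q) :
    IsOpen {g : HomeoHaar | ∀ x, p (map g x) = q x} :=
  (_root_.isOpen_setOf_forall_comp_eq hp hq).preimage isInducing_coe.continuous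

theorem IsCompact.exists_trunc {K U : Set Cantor} (hK : IsCompact K) (hU : IsOpen U)
    (hKU : K ⊆ U) : ∃ N, ∀ x ∈ K, ∀ y, trunc N x = trunc N y → y ∈ U := by
  let W : ℕ → Set Cantor := fun N => {x | ∀ y, trunc N x = trunc N y → y ∈ U}
  have hopen : ∀ N, IsOpen (W N) := fun N => by
    rw [isOpen_iff_mem_nhds]
    intro x hx
    filter_upwards [((isLocallyConstant_trunc N).isOpen_fiber (trunc N x)).mem_nhds rfl]
      with y hy z hz using hx z (hy.symm.trans hz)
  have hcov : K ⊆ ⋃ N, W N := by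
    intro x hx
    obtain ⟨_, ⟨z, n, rfl⟩, hxz, hsub⟩ :=
      (PiNat.isTopologicalBasis_cylinders (E := fun _ => Bool)).mem_nhds_iff.1
        (hU.mem_nhds (hKU hx))
    refine Set.mem_iUnion.2 ⟨n, fun y hy => hsub ?_⟩
    rw [PiNat.mem_cylinder_iff] at hxz ⊢
    exact fun i hi => (congrFun hy ⟨i, hi⟩).symm.trans (hxz i hi)
  have hmono : Monotone W := fun m n hmn x hx y hy => hx y (trunc_eq_of_le hmn hy)
  exact hK.elim_directed_cover W hopen hcov hmono.directed_le

/-- A set of measure preserving homeomorphisms is dense as soon as it realizes the truncations of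
all elements. -/
theorem HomeoHaar.dense_of_forall_trunc {S : Set HomeoHaar}
    (h : ∀ (g : HomeoHaar) (M : ℕ), ∃ f ∈ S, ∀ x, trunc M (map f x) = trunc M (map g x)) :
    Dense S := by
  intro g
  choose f hfS hf using h g
  refine mem_closure_of_tendsto (b := Filter.atTop) (f := f) ?_ (Filter.Eventually.of_forall hfS)
  rw [isInducing_coe.tendsto_nhds_iff, ContinuousMap.tendsto_nhds_compactOpen]
  intro K hK U hU hKU
  obtain ⟨N, hN⟩ := (hK.image (continuous_map g)).exists_trunc hU (Set.image_subset_iff.2 hKU)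
  filter_upwards [Filter.eventually_ge_atTop N] with m hm x hx
  exact hN _ ⟨x, hx, rfl⟩ _ (trunc_eq_of_le hm (hf m x).symm)

/-- $g^{-1}K\subseteq U$ means $g(U^c)\subseteq K^c$, again a subbasic condition because $U^c$ is
compact. -/
theorem HomeoHaar.continuous_coe_inv :
    Continuous fun g : HomeoHaar =>
      (((g⁻¹ : HomeoHaar) : Cantor ≃ₜ Cantor) : C(Cantor, Cantor)) := by
  rw [ContinuousMap.continuous_compactOpen]
  intro K hK U hU
  have : {g : HomeoHaar | Set.MapsTo (((g⁻¹ : HomeoHaar) : Cantor ≃ₜ Cantor) : C(Cantor, Cantor))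
      K U} = (fun g : HomeoHaar => ((g : Cantor ≃ₜ Cantor) : C(Cantor, Cantor))) ⁻¹'
        {f | Set.MapsTo f Uᶜ Kᶜ} := by
    ext g
    constructor
    · intro h x hx hgx
      exact hx (map_inv_map g x ▸ (h hgx : map g⁻¹ (map g x) ∈ U))
    · intro h x hx
      by_contra hgx
      exact h hgx ((map_map_inv g x).symm ▸ hx : map g (map g⁻¹ x) ∈ K)
  rw [this]
  exact (ContinuousMap.isOpen_setOfPred_mapsTo hU.isClosed_compl.isCompact
    hK.isClosed.isOpen_compl).preimage isInducing_coe.continuous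

/-- This yields complete metrizability, hence the Baire property. The inverse is recorded because a
uniform limit of homeomorphisms need not be invertible. -/
theorem HomeoHaar.isClosedEmbedding_coe_prod_inv :
    Topology.IsClosedEmbedding fun g : HomeoHaar =>
      (((g : Cantor ≃ₜ Cantor) : C(Cantor, Cantor)),
        (((g⁻¹ : HomeoHaar) : Cantor ≃ₜ Cantor) : C(Cantor, Cantor))) := by
  refine ⟨⟨Topology.IsInducing.of_comp (isInducing_coe.continuous.prodMk continuous_coe_inv)
    continuous_fst isInducing_coe, ?_⟩, ?_⟩
  · intro g h hgh
    exact ext_map fun x => DFunLike.congr_fun (Prod.ext_iff.1 hgh).1 x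
  · rw [← closure_subset_iff_isClosed]
    rintro ⟨a, b⟩ hab
    have hcl : IsClosed {q : C(Cantor, Cantor) × C(Cantor, Cantor) |
        q.1.comp q.2 = ContinuousMap.id _ ∧ q.2.comp q.1 = ContinuousMap.id _} :=
      (isClosed_eq (continuous_fst.compCM continuous_snd) continuous_const).inter
        (isClosed_eq (continuous_snd.compCM continuous_fst) continuous_const)
    have hinv : a.comp b = ContinuousMap.id _ ∧ b.comp a = ContinuousMap.id _ := by
      refine closure_minimal ?_ hcl hab
      rintro _ ⟨g, rfl⟩
      exact ⟨ContinuousMap.ext fun x => map_map_inv g x,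
        ContinuousMap.ext fun x => map_inv_map g x⟩
    -- A nearby group element has the same first `k` digits as `a` everywhere, so equidistribution
    -- passes to the limit.
    have hmp : MeasurePreserving a cantorHaar cantorHaar := by
      refine measurePreserving_of_equidistributed a.continuous fun k => ?_
      have hopen : IsOpen {q : C(Cantor, Cantor) × C(Cantor, Cantor) |
          ∀ x, trunc k (q.1 x) = trunc k (a x)} :=
        (_root_.isOpen_setOf_forall_comp_eq (isLocallyConstant_trunc k)
          ((IsLocallyConstant.iff_continuous _).2
            ((continuous_trunc k).comp a.continuous))).preimage continuous_fst
      obtain ⟨_, hg, g, rfl⟩ := mem_closure_iff.1 hab _ hopen fun x => rfl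
      have : (fun x => trunc k (a x)) = fun x => trunc k (map g x) := funext fun x => (hg x).symm
      rw [this]
      exact equidistributed_trunc_map g k
    refine ⟨⟨⟨⟨a, b, fun x => DFunLike.congr_fun hinv.2 x, fun x => DFunLike.congr_fun hinv.1 x⟩,
      a.continuous, b.continuous⟩, hmp⟩, ?_⟩
    exact Prod.ext (ContinuousMap.ext fun x => rfl) (ContinuousMap.ext fun x => rfl)

instance ContinuousMap.isCompletelyMetrizableSpace {X Y : Type*} [TopologicalSpace X]
    [CompactSpace X] [TopologicalSpace Y] [TopologicalSpace.IsCompletelyMetrizableSpace Y] :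
    TopologicalSpace.IsCompletelyMetrizableSpace C(X, Y) := by
  let := TopologicalSpace.upgradeIsCompletelyMetrizable Y
  infer_instance

instance HomeoHaar.baireSpace : BaireSpace HomeoHaar := by
  have := HomeoHaar.isClosedEmbedding_coe_prod_inv.IsCompletelyMetrizableSpace
  infer_instance

/-! ### A comeagre set of measure preserving homeomorphisms -/

/-- The homeomorphism permutes the words of length `m` for arbitrarily large `m`. -/
def PermutesWords (g : HomeoHaar) : Prop :=
  ∀ N, ∃ m ≥ N, ∃ σ : Equiv.Perm (Word m), ∀ x, trunc m (map g x) = σ (trunc m x)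

/-- Every extension, given by a cocycle `t`, of the finite dynamics on words is realized by an
equidistributed map. -/
def RealizesCocycles (g : HomeoHaar) : Prop :=
  ∀ (N j : ℕ) (t : Word N → Equiv.Perm (Word j)), ∃ s : Cantor → Word j,
    Equidistributed (fun x => (trunc N x, s x)) ∧ ∀ x, s (map g x) = t (trunc N x) (s x)

/-- The conditions that single out the generic measure preserving homeomorphisms. -/
structure IsUniversal (g : HomeoHaar) : Prop where
  permutesWords : PermutesWords g
  realizesCocycles : RealizesCocycles g

/-- For density, `trunc M ∘ g` and `trunc M` are both equidistributed, so some permutation of long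
words agrees with `g` on the first `M` digits. -/
theorem eventually_residual_permutesWords : ∀ᶠ g in residual HomeoHaar, PermutesWords g := by
  refine eventually_countable_forall.2 fun N => residual_of_dense_open ?_ ?_
  · have : {g | ∃ m ≥ N, ∃ σ : Equiv.Perm (Word m), ∀ x, trunc m (map g x) = σ (trunc m x)} =
        ⋃ m, ⋃ (_ : m ≥ N), ⋃ σ : Equiv.Perm (Word m),
          {g | ∀ x, trunc m (map g x) = σ (trunc m x)} := by
      ext g
      simp
    refine this ▸ isOpen_iUnion fun m => isOpen_iUnion fun _ => isOpen_iUnion fun σ => ?_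
    exact HomeoHaar.isOpen_setOf_forall_comp_eq (isLocallyConstant_trunc m)
      ((isLocallyConstant_trunc m).comp σ)
  · refine dense_of_forall_trunc fun g M => ?_
    obtain ⟨n, hn, e, he⟩ := (equidistributed_trunc_map g M).exists_perm (equidistributed_trunc M) N
    exact ⟨permHaar e, ⟨n, hn, e, trunc_map_permHaar e⟩, he⟩

theorem eventually_residual_realizesCocycles :
    ∀ᶠ g in residual HomeoHaar, RealizesCocycles g := by
  refine eventually_countable_forall.2 fun N => eventually_countable_forall.2 fun j =>
    eventually_countable_forall.2 fun t => residual_of_dense_open ?_ ?_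
  · have : {g | ∃ s : Cantor → Word j, Equidistributed (fun x => (trunc N x, s x)) ∧
          ∀ x, s (map g x) = t (trunc N x) (s x)} =
        ⋃ s : Cantor → Word j, ⋃ (_ : Equidistributed fun x => (trunc N x, s x)),
          {g | ∀ x, s (map g x) = t (trunc N x) (s x)} := by
      ext g
      simp
    refine this ▸ isOpen_iUnion fun s => isOpen_iUnion fun hs => ?_
    exact HomeoHaar.isOpen_setOf_forall_comp_eq (hs.isLocallyConstant.comp Prod.snd)
      (hs.isLocallyConstant.comp fun c => t c.1 c.2)
  · refine dense_of_forall_trunc fun g M => ?_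
    obtain ⟨n, hn, e, he⟩ := (equidistributed_trunc_map g (max M N)).exists_perm
      (equidistributed_trunc (max M N)) (max M N)
    have hM : M ≤ n := (le_max_left M N).trans hn
    have hN : N ≤ n := (le_max_right M N).trans hn
    obtain ⟨s, hs⟩ := (equidistributed_trunc n).exists_prod j
    -- `e'` acts on the first `n` digits and the next block `s` as the skew product of `e` with `t`.
    obtain ⟨_, _, e', he'⟩ := (hs.comp (EquiFibered.of_equiv
      (Equiv.prodShear e fun d => t (wordTrunc hN d)))).exists_perm hs 0
    refine ⟨permHaar e', ⟨s, hs.comp ((equiFibered_wordTrunc hN).prodMap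
      (EquiFibered.of_equiv (Equiv.refl (Word j)))), fun x => (Prod.ext_iff.1 (he' x)).2⟩,
      fun x => ?_⟩
    have h1 : trunc n (map (permHaar e') x) = trunc n (map (permHaar e) x) :=
      (Prod.ext_iff.1 (he' x)).1.trans (trunc_map_permHaar e x).symm
    exact (trunc_eq_of_le hM h1).trans (trunc_eq_of_le (le_max_left M N) (he x))

theorem eventually_residual_isUniversal : ∀ᶠ g in residual HomeoHaar, IsUniversal g := by
  filter_upwards [eventually_residual_permutesWords, eventually_residual_realizesCocycles]
    with g h₁ h₂ using ⟨h₁, h₂⟩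

theorem RealizesCocycles.exists_of_equidistributed {g : HomeoHaar} (hg : RealizesCocycles g)
    {C K : Type} {p : Cantor → C} (hp : Equidistributed p) {j : ℕ} (hK : Nat.card K = 2 ^ j)
    (t : C → Equiv.Perm K) : ∃ s : Cantor → K,
      Equidistributed (fun x => (p x, s x)) ∧ ∀ x, s (map g x) = t (p x) (s x) := by
  have : Finite K := Nat.finite_of_card_ne_zero (by simp [hK])
  obtain ⟨κ⟩ : Nonempty (K ≃ Word j) := Finite.card_eq.1 (by simp [hK])
  obtain ⟨n, f, hf, hpf⟩ := hp
  obtain ⟨s, hs, hst⟩ := hg n j fun d => (κ.symm.trans (t (f d))).trans κ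
  refine ⟨fun x => κ.symm (s x), ?_, fun x => ?_⟩
  · simp only [hpf]
    exact hs.comp (hf.prodMap (EquiFibered.of_equiv κ.symm))
  · simp [hst, hpf]

/-! ### Powers -/

theorem PermutesWords.pow {g : HomeoHaar} (hg : PermutesWords g) (k : ℕ) :
    PermutesWords (g ^ k) := by
  intro N
  obtain ⟨m, hm, σ, hσ⟩ := hg N
  refine ⟨m, hm, σ ^ k, ?_⟩
  induction k with
  | zero => exact fun x => rfl
  | succ k ih => exact fun x => by rw [pow_succ, map_mul, ih, hσ, pow_succ, Equiv.Perm.mul_apply]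

theorem PermutesWords.inv {g : HomeoHaar} (hg : PermutesWords g) : PermutesWords g⁻¹ := by
  intro N
  obtain ⟨m, hm, σ, hσ⟩ := hg N
  refine ⟨m, hm, σ⁻¹, fun x => ?_⟩
  rw [Equiv.Perm.eq_inv_iff_eq, ← hσ, map_map_inv]

/-- Shift a tuple to the left, filling in at the end the image of its first entry. -/
def shiftPerm {K : Type} (m : ℕ) (t : Equiv.Perm K) : Equiv.Perm (Fin (m + 1) → K) where
  toFun k := Fin.snoc (α := fun _ => K) (fun i : Fin m => k i.succ) (t (k 0))
  invFun l := Fin.cons (α := fun _ => K) (t.symm (l (Fin.last m))) (fun i : Fin m => l i.castSucc)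
  left_inv k := by
    ext i
    refine Fin.cases ?_ (fun i => ?_) i <;> simp
  right_inv l := by
    ext i
    refine Fin.lastCases ?_ (fun i => ?_) i <;> simp

/-- The cocycle `shiftPerm m (t d)` on tuples acts as a delay line: the entry `t d (k 0)` appended
at one step reaches position 0 after `m` more, so `g ^ (m + 1)` acts on the first entry by `t`. -/
theorem RealizesCocycles.pow_succ {g : HomeoHaar} (hg : RealizesCocycles g) (m : ℕ) :
    RealizesCocycles (g ^ (m + 1)) := by
  intro N j t
  obtain ⟨s, hs, hst⟩ := hg.exists_of_equidistributed (equidistributed_trunc N)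
    (K := Fin (m + 1) → Word j) (j := j * (m + 1)) (by simp [pow_mul])
    fun d => shiftPerm m (t d)
  refine ⟨fun x => s x 0, hs.comp ((EquiFibered.of_equiv (Equiv.refl (Word N))).prodMap
    (EquiFibered.eval_zero (Word j) m)), fun x => ?_⟩
  have key : ∀ (i : ℕ) (hi : i < m + 1) (x : Cantor), s (map (g ^ i) x) 0 = s x ⟨i, hi⟩ := by
    intro i
    induction i with
    | zero => exact fun _ x => rfl
    | succ i ih =>
      intro hi x
      rw [_root_.pow_succ, map_mul, ih (by omega), hst]
      exact Fin.snoc_castSucc (α := fun _ => Word j) (t (trunc N x) (s x 0))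
        (fun i : Fin m => s x i.succ) ⟨i, by omega⟩
  change s (map (g ^ (m + 1)) x) 0 = t (trunc N x) (s x 0)
  rw [_root_.pow_succ, map_mul, key m (Nat.lt_succ_self m), hst]
  exact Fin.snoc_last (α := fun _ => Word j) (t (trunc N x) (s x 0)) fun i : Fin m => s x i.succ

/-- Read at $g^{-1}x$, the equation for $g^{-1}$ asks for the cocycle $t(gx)^{-1}$ along $g$. It
depends on finitely many digits of $x$ because $g$ permutes words of some length `m ≥ N`. -/
theorem IsUniversal.inv {g : HomeoHaar} (hg : IsUniversal g) : IsUniversal g⁻¹ := by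
  refine ⟨hg.permutesWords.inv, fun N j t => ?_⟩
  obtain ⟨m, hm, σ, hσ⟩ := hg.permutesWords N
  obtain ⟨s, hs, hst⟩ := hg.realizesCocycles m j fun d => (t (wordTrunc hm (σ d)))⁻¹
  refine ⟨s, hs.comp ((equiFibered_wordTrunc hm).prodMap
    (EquiFibered.of_equiv (Equiv.refl (Word j)))), fun x => ?_⟩
  have h := hst (map g⁻¹ x)
  rw [← hσ, map_map_inv, wordTrunc_trunc, Equiv.Perm.eq_inv_iff_eq] at h
  exact h.symm

theorem IsUniversal.zpow {g : HomeoHaar} (hg : IsUniversal g) {n : ℤ} (hn : n ≠ 0) :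
    IsUniversal (g ^ n) := by
  have hpow : ∀ m : ℕ, IsUniversal (g ^ (m + 1)) := fun m =>
    ⟨hg.permutesWords.pow _, hg.realizesCocycles.pow_succ m⟩
  obtain ⟨m, rfl | rfl⟩ := n.eq_nat_or_neg
  · obtain ⟨k, rfl⟩ := Nat.exists_eq_succ_of_ne_zero (n := m) (by omega)
    rw [zpow_natCast]
    exact hpow k
  · obtain ⟨k, rfl⟩ := Nat.exists_eq_succ_of_ne_zero (n := m) (by omega)
    rw [zpow_neg, zpow_natCast]
    exact (hpow k).inv

/-! ### Back and forth -/

/-- A common finite factor of two measure preserving homeomorphisms. -/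
structure CommonFactor (g g' : HomeoHaar) where
  /-- The points of the factor. -/
  C : Type
  /-- The dynamics on the factor. -/
  σ : C → C
  /-- The factor map of the first homeomorphism. -/
  p : Cantor → C
  /-- The factor map of the second homeomorphism. -/
  p' : Cantor → C
  equidistributed : Equidistributed p
  equidistributed' : Equidistributed p'
  semiconj : ∀ x, p (map g x) = σ (p x)
  semiconj' : ∀ x, p' (map g' x) = σ (p' x)

namespace CommonFactor

variable {g g' : HomeoHaar}

/-- The trivial common factor. -/
def trivial (g g' : HomeoHaar) : CommonFactor g g' :=
  ⟨Unit, id, fun _ => (), fun _ => (), .unit, .unit, fun _ => rfl, fun _ => rfl⟩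

/-- Exchange the two homeomorphisms. -/
def swap (a : CommonFactor g g') : CommonFactor g' g :=
  ⟨a.C, a.σ, a.p', a.p, a.equidistributed', a.equidistributed, a.semiconj', a.semiconj⟩

/-- The common factor `b` refines `a`. -/
def Refines (b a : CommonFactor g g') : Prop :=
  ∃ π : b.C → a.C, (∀ x, π (b.p x) = a.p x) ∧ ∀ x, π (b.p' x) = a.p' x

theorem Refines.trans {a b c : CommonFactor g g'} (hcb : c.Refines b) (hba : b.Refines a) :
    c.Refines a := by
  obtain ⟨π, h, h'⟩ := hcb
  obtain ⟨ρ, i, i'⟩ := hba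
  exact ⟨fun z => ρ (π z), fun x => (congrArg ρ (h x)).trans (i x),
    fun x => (congrArg ρ (h' x)).trans (i' x)⟩

theorem Refines.swap {a b : CommonFactor g g'} (h : b.Refines a) : b.swap.Refines a.swap := by
  obtain ⟨π, h, h'⟩ := h
  exact ⟨π, h', h⟩

/-- The first factor map determines the first `N` digits. -/
def Determines (a : CommonFactor g g') (N : ℕ) : Prop :=
  ∃ f : a.C → Word N, EquiFibered f ∧ ∀ x, f (a.p x) = trunc N x

/-- Long words refine `a.p`, with fibre `K` of size a power of 2. The action of `g` on them is a
skew product over `a.σ`, which `g'` can realize over `a.p'`. -/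
theorem exists_refines (hg : PermutesWords g) (hg' : RealizesCocycles g') (a : CommonFactor g g')
    (N : ℕ) : ∃ b : CommonFactor g g', b.Refines a ∧ b.Determines N ∧
      ∀ M, a.swap.Determines M → b.swap.Determines M := by
  obtain ⟨n, hn⟩ := a.equidistributed.exists_factor
  obtain ⟨m, hm, ε, hε⟩ := hg (max n N)
  obtain ⟨f, ⟨K, e, he⟩, hpf⟩ := hn m ((le_max_left n N).trans hm)
  have hfin : Finite (a.C × K) := Finite.of_equiv _ e
  have : Nonempty a.C := ⟨a.p fun _ => false⟩
  have hK : Finite K := Finite.prod_right a.C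
  have hcard := Nat.card_congr e
  rw [Nat.card_prod] at hcard
  obtain ⟨j, -, hj⟩ := (Nat.dvd_prime_pow Nat.prime_two).1
    (Dvd.intro_left _ (hcard.symm.trans (by simp)) : Nat.card K ∣ 2 ^ m)
  let T : Equiv.Perm (a.C × K) := (e.symm.trans ε).trans e
  -- Since `T` covers `a.σ`, injectivity of `T` makes it a permutation on each fibre, even if `a.σ`
  -- were not known to be injective.
  have hT : ∀ z : a.C × K, (T z).1 = a.σ z.1 := by
    intro z
    obtain ⟨x, hx⟩ := trunc_surjective m (e.symm z)
    have h := a.semiconj x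
    rw [hpf, hpf, hε, hx, ← he, ← he, Equiv.apply_symm_apply] at h
    exact h
  have hinj : ∀ c, Function.Injective fun k => (T (c, k)).2 := by
    intro c k l hkl
    have : T (c, k) = T (c, l) := Prod.ext ((hT (c, k)).trans (hT (c, l)).symm) hkl
    exact (Prod.ext_iff.1 (T.injective this)).2
  let t : a.C → Equiv.Perm K := fun c =>
    Equiv.ofBijective _ (Finite.injective_iff_bijective.1 (hinj c))
  obtain ⟨s, hs, hst⟩ := hg'.exists_of_equidistributed a.equidistributed' hj t
  let b : CommonFactor g g' :=
    { C := a.C × K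
      σ := T
      p := fun x => e (trunc m x)
      p' := fun x => (a.p' x, s x)
      equidistributed := (equidistributed_trunc m).comp (EquiFibered.of_equiv e)
      equidistributed' := hs
      semiconj := fun x => by simp [T, hε]
      semiconj' := fun x => Prod.ext ((a.semiconj' x).trans (hT (a.p' x, s x)).symm) (hst x) }
  refine ⟨b, ⟨Prod.fst, fun x => (he _).trans (hpf x).symm, fun x => rfl⟩, ?_, ?_⟩
  · have hN : N ≤ m := (le_max_right n N).trans hm
    refine ⟨fun z => wordTrunc hN (e.symm z),
      (equiFibered_wordTrunc hN).comp (EquiFibered.of_equiv e.symm), fun x => ?_⟩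
    simp [b, wordTrunc_trunc]
  · rintro M ⟨u, hu, hux⟩
    exact ⟨fun z => u z.1, hu.comp (EquiFibered.fst K), hux⟩

theorem exists_refines_both (hg : IsUniversal g) (hg' : IsUniversal g') (a : CommonFactor g g')
    (N : ℕ) : ∃ b : CommonFactor g g', b.Refines a ∧ b.Determines N ∧ b.swap.Determines N := by
  obtain ⟨b, hba, hb, -⟩ := exists_refines hg.permutesWords hg'.realizesCocycles a N
  obtain ⟨c, hcb, hc, hbc⟩ := exists_refines hg'.permutesWords hg.realizesCocycles b.swap N
  exact ⟨c.swap, hcb.swap.trans hba, hbc N hb, hc⟩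

theorem exists_seq (hg : IsUniversal g) (hg' : IsUniversal g') :
    ∃ a : ℕ → CommonFactor g g', ∀ n, (a (n + 1)).Refines (a n) ∧ (a (n + 1)).Determines n ∧
      (a (n + 1)).swap.Determines n := by
  choose next hnext using exists_refines_both hg hg'
  exact ⟨fun n => Nat.rec (trivial g g') (fun k b => next b k) n, fun n => hnext _ n⟩

/-- The fibres are nonempty, compact and nested, so they have a common point. -/
theorem exists_forall_eq {a : ℕ → CommonFactor g g'} (ha : ∀ n, (a (n + 1)).Refines (a n))
    (x : Cantor) : ∃ y, ∀ n, (a n).p' y = (a n).p x := by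
  have hclosed : ∀ n, IsClosed {y | (a n).p' y = (a n).p x} := fun n =>
    (a n).equidistributed'.isLocallyConstant.isClosed_fiber _
  have h := IsCompact.nonempty_iInter_of_sequence_nonempty_isCompact_isClosed
    (fun n => {y | (a n).p' y = (a n).p x}) (fun n y hy => ?_)
    (fun n => (a n).equidistributed'.surjective _) (hclosed 0).isCompact hclosed
  · obtain ⟨y, hy⟩ := h
    exact ⟨y, Set.mem_iInter.1 hy⟩
  · obtain ⟨π, h, h'⟩ := ha n
    exact (h' y).symm.trans ((congrArg π hy).trans (h x))

theorem eq_of_forall_eq {a : ℕ → CommonFactor g g'} (ha : ∀ n, (a (n + 1)).Determines n)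
    {x y : Cantor} (h : ∀ n, (a n).p x = (a n).p y) : x = y := by
  refine ext_trunc fun n => ?_
  obtain ⟨f, -, hf⟩ := ha n
  rw [← hf, h, hf]

theorem equidistributed_trunc_of_forall_eq {a : ℕ → CommonFactor g g'}
    (ha : ∀ n, (a (n + 1)).swap.Determines n) {h : Cantor → Cantor}
    (hh : ∀ x n, (a n).p' (h x) = (a n).p x) (n : ℕ) : Equidistributed fun x => trunc n (h x) := by
  obtain ⟨f, hf, hfx⟩ := ha n
  have : (fun x => trunc n (h x)) = fun x => f ((a (n + 1)).p x) :=
    funext fun x => (hfx (h x)).symm.trans (congrArg f (hh x (n + 1)))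
  rw [this]
  exact (a (n + 1)).equidistributed.comp hf

end CommonFactor

theorem continuous_of_equidistributed_trunc {h : Cantor → Cantor}
    (hh : ∀ n, Equidistributed fun x => trunc n (h x)) : Continuous h :=
  continuous_pi fun i =>
    (continuous_apply (Fin.last i)).comp (hh (i + 1)).isLocallyConstant.continuous

/-- Any two universal measure preserving homeomorphisms are conjugate. -/
theorem IsUniversal.isConj {g g' : HomeoHaar} (hg : IsUniversal g) (hg' : IsUniversal g') :
    IsConj g g' := by
  obtain ⟨a, ha⟩ := CommonFactor.exists_seq hg hg'
  choose h hh using CommonFactor.exists_forall_eq fun n => (ha n).1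
  choose k hk using CommonFactor.exists_forall_eq (a := fun n => (a n).swap)
    fun n => (ha n).1.swap
  have hh_equi := CommonFactor.equidistributed_trunc_of_forall_eq (fun n => (ha n).2.2) hh
  have hk_equi := CommonFactor.equidistributed_trunc_of_forall_eq (a := fun n => (a n).swap)
    (fun n => (ha n).2.1) hk
  have hc := continuous_of_equidistributed_trunc hh_equi
  have hinj' : ∀ {x y}, (∀ n, (a n).p' x = (a n).p' y) → x = y :=
    CommonFactor.eq_of_forall_eq (a := fun n => (a n).swap) fun n => (ha n).2.2
  let H : HomeoHaar := ⟨⟨⟨h, k,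
    fun x => CommonFactor.eq_of_forall_eq (fun n => (ha n).2.1) fun n =>
      (hk (h x) n).trans (hh x n),
    fun x => hinj' fun n => (hh (k x) n).trans (hk x n)⟩, hc,
    continuous_of_equidistributed_trunc hk_equi⟩, measurePreserving_of_equidistributed hc hh_equi⟩
  refine isConj_iff.2 ⟨H, mul_inv_eq_iff_eq_mul.2 (ext_map fun x => hinj' fun n => ?_)⟩
  change (a n).p' (h (map g x)) = (a n).p' (map g' (h x))
  rw [hh, (a n).semiconj, (a n).semiconj', hh]

/-! ### Roots and rational actions -/

section RationalAction

variable {G : Type*} [Group G] {u : ℕ → G}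

theorem exists_pow_eq_of_root_seq (hu : ∀ k, u (k + 1) ^ (k + 1) = u k) (k j : ℕ) :
    ∃ m : ℕ, u (k + j) ^ m = u k ∧ k.factorial * m = (k + j).factorial := by
  induction j with
  | zero => exact ⟨1, by simp, by simp⟩
  | succ j ih =>
    obtain ⟨m, hm, hfac⟩ := ih
    refine ⟨(k + j + 1) * m, ?_, ?_⟩
    · rw [pow_mul, ← add_assoc, hu, hm]
    · rw [← add_assoc, Nat.factorial_succ, ← hfac]
      ring

theorem zpow_eq_of_root_seq (hu : ∀ k, u (k + 1) ^ (k + 1) = u k) {k l : ℕ} (hkl : k ≤ l)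
    {z w : ℤ} (h : (z : ℚ) / k.factorial = w / l.factorial) : u k ^ z = u l ^ w := by
  obtain ⟨j, rfl⟩ := Nat.exists_eq_add_of_le hkl
  obtain ⟨m, hm, hfac⟩ := exists_pow_eq_of_root_seq hu k j
  have hk : (k.factorial : ℚ) ≠ 0 := by exact_mod_cast k.factorial_ne_zero
  have hm0 : (m : ℚ) ≠ 0 := by
    rintro h0
    have : m = 0 := by exact_mod_cast h0
    exact (k + j).factorial_ne_zero (by rw [← hfac, this, mul_zero])
  rw [← hfac] at h
  push_cast at h
  field_simp at h
  have hw : (m : ℤ) * z = w := by exact_mod_cast (mul_comm _ _).trans h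
  rw [← hm, ← hw, zpow_mul, zpow_natCast]

theorem exists_int_eq_div_factorial (q : ℚ) {k : ℕ} (hk : q.den ≤ k) :
    ∃ z : ℤ, (z : ℚ) / k.factorial = q := by
  obtain ⟨m, hm⟩ := Nat.dvd_factorial q.den_pos hk
  have hd : (q.den : ℚ) ≠ 0 := by exact_mod_cast q.den_ne_zero
  have hm0 : (m : ℚ) ≠ 0 := by
    rintro h0
    have : m = 0 := by exact_mod_cast h0
    exact k.factorial_ne_zero (by rw [hm, this, mul_zero])
  refine ⟨q.num * m, ?_⟩
  rw [hm]
  push_cast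
  rw [mul_div_mul_right _ _ hm0, Rat.num_div_den]

/-- Compatible roots of all orders assemble to a homomorphism from the rational numbers. -/
theorem exists_hom_of_root_seq (hu : ∀ k, u (k + 1) ^ (k + 1) = u k) :
    ∃ a : Multiplicative ℚ →* G, a (Multiplicative.ofAdd 1) = u 0 := by
  choose z hz using fun q : ℚ => exists_int_eq_div_factorial q le_rfl
  have key : ∀ (q : ℚ) (k : ℕ) (w : ℤ), (w : ℚ) / k.factorial = q → u q.den ^ z q = u k ^ w := by
    intro q k w hw
    rcases le_total q.den k with h | h
    · exact zpow_eq_of_root_seq hu h ((hz q).trans hw.symm)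
    · exact (zpow_eq_of_root_seq hu h (hw.trans (hz q).symm)).symm
  refine ⟨MonoidHom.mk' (fun q => u q.toAdd.den ^ z q.toAdd) fun q r => ?_, ?_⟩
  · obtain ⟨v, hv⟩ := exists_int_eq_div_factorial q.toAdd (le_max_left q.toAdd.den r.toAdd.den)
    obtain ⟨w, hw⟩ := exists_int_eq_div_factorial r.toAdd (le_max_right q.toAdd.den r.toAdd.den)
    rw [key _ _ _ hv, key _ _ _ hw, ← zpow_add]
    refine key _ _ _ ?_
    rw [toAdd_mul, Int.cast_add, add_div, hv, hw]
  · exact (key 1 0 1 (by simp)).trans (zpow_one _)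

/-- An element whose conjugates are conjugate to their positive powers extends to a homomorphism
from the rational numbers. -/
theorem exists_hom_of_isConj_pow {g : G} (hg : ∀ n : ℕ, n ≠ 0 → IsConj g (g ^ n)) :
    ∃ a : Multiplicative ℚ →* G, a (Multiplicative.ofAdd 1) = g := by
  have root : ∀ (x : {x : G // IsConj g x}) (n : ℕ),
      ∃ y : {x : G // IsConj g x}, (y : G) ^ (n + 1) = x := by
    rintro ⟨x, hx⟩ n
    obtain ⟨c, hc⟩ := isConj_iff.1 ((hg (n + 1) n.succ_ne_zero).symm.trans hx)
    exact ⟨⟨c * g * c⁻¹, isConj_iff.2 ⟨c, rfl⟩⟩, by rw [conj_pow, hc]⟩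
  choose r hr using root
  let v : ℕ → {x : G // IsConj g x} := fun n => Nat.rec ⟨g, IsConj.refl g⟩ (fun k x => r x k) n
  have hv : ∀ k : ℕ, (v (k + 1)).1 ^ (k + 1) = (v k).1 := fun k => hr (v k) k
  exact exists_hom_of_root_seq (u := fun n : ℕ => (v n).1) hv

end RationalAction

theorem isGenericElement_of_isUniversal {g : HomeoHaar} (hg : IsUniversal g) :
    IsGenericElement g := by
  filter_upwards [eventually_residual_isUniversal] with h hh using hg.isConj hh

theorem IsGenericElement.exists_isUniversal {g : HomeoHaar} (hg : IsGenericElement g) :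
    ∃ s, IsUniversal s ∧ IsConj g s := by
  obtain ⟨s, hs⟩ := (dense_of_mem_residual
    (Filter.inter_mem eventually_residual_isUniversal hg)).nonempty
  exact ⟨s, hs⟩

theorem IsGenericElement.isConj_zpow {g : HomeoHaar} (hg : IsGenericElement g) {n : ℤ}
    (hn : n ≠ 0) : IsConj g (g ^ n) := by
  obtain ⟨s, hs, hgs⟩ := hg.exists_isUniversal
  have hpow : IsConj (s ^ n) (g ^ n) := by
    obtain ⟨c, rfl⟩ := isConj_iff.1 hgs.symm
    exact isConj_iff.2 ⟨c, conj_zpow.symm⟩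
  exact (hgs.trans (hs.isConj (hs.zpow hn))).trans hpow

theorem theorem2p5 :
    (∃ g : HomeoHaar, IsGenericElement g) ∧
    ∀ g : HomeoHaar, IsGenericElement g →
      (∀ n : ℤ, n ≠ 0 → IsConj g (g ^ n)) ∧
      (∀ n : ℕ, n ≠ 0 → ∃ f : HomeoHaar, f ^ n = g) ∧
      ∃ a : Multiplicative ℚ →* HomeoHaar, a (Multiplicative.ofAdd 1) = g := by
  refine ⟨?_, fun g hg => ?_⟩
  · obtain ⟨g, hg⟩ := (dense_of_mem_residual eventually_residual_isUniversal).nonempty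
    exact ⟨g, isGenericElement_of_isUniversal hg⟩
  · have hpow : ∀ n : ℕ, n ≠ 0 → IsConj g (g ^ n) := fun n hn => by
      simpa using hg.isConj_zpow (Int.natCast_ne_zero.2 hn)
    refine ⟨fun n hn => hg.isConj_zpow hn, fun n hn => ?_, exists_hom_of_isConj_pow hpow⟩
    obtain ⟨c, hc⟩ := isConj_iff.1 (hpow n hn).symm
    exact ⟨c * g * c⁻¹, by rw [conj_pow, hc]⟩
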